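/- All topological spaces below are nonempty $T_1$-spaces without isolated points. For a space $X$ and $A\subseteq X$ let $cl_\theta(A)$ be the set of all $x\in X$ such that $\overline{U}\cap A\neq\emptyset$ for every neighborhood $U$ of $x$. A set $D\subseteq X$ is $\theta$-dense if $cl_\theta(D)=X$, and $\mathcal{D}_\theta$ denotes the family of all $\theta$-dense subsets of $X$. Let $\delta_\theta(X)$ be the least infinite cardinal $\lambda$ such that every $\theta$-dense $D\subseteq X$ contains a $\theta$-dense $C\subseteq D$ with $|C|\le\lambda$. Let $\pi_\theta(X)$ be the least cardinality of a family $\mathcal{V}$ of nonempty open subsets of $X$ such that for every nonempty open $U\subseteq X$ there is $V\in\mathcal{V}$ with $V\subseteq\overline{U}$. Let $\mathsf{cov}(\mathcal{M})$ be the least cardinality of a family of meager subsets of $\mathbb{R}$ whose union is $\mathbb{R}$. For families $\mathcal{A},\mathcal{B}$ of sets, the selection principle $\mathsf{S}_1(\mathcal{A},\mathcal{B})$ states: for each sequence $(A_n)_{n<\omega}$ of elements of $\mathcal{A}$ there are $b_n\in A_n$ $(n<\omega)$ with $\{b_n:n<\omega\}\in\mathcal{B}$. In the game $\mathsf{G}_1(\mathcal{A},\mathcal{B})$,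 in each inning $n<\omega$ player ONE chooses $O_n\in\mathcal{A}$ and player TWO responds with $T_n\in O_n$; TWO wins the play if $\{T_n:n<\omega\}\in\mathcal{B}$, and otherwise ONE wins. **Theorem.** For every infinite cardinal $\kappa$ the following are equivalent: 1. $\kappa<\mathsf{cov}(\mathcal{M})$. 2. For each space $X$ with $\delta_\theta(X)=\aleph_0$ and $\pi_\theta(X)\le\kappa$, ONE has no winning strategy in the game $\mathsf{G}_1(\mathcal{D}_\theta,\mathcal{D}_\theta)$. 3. For each space $X$ with $\delta_\theta(X)=\aleph_0$ and $\pi_\theta(X)\le\kappa$, the selection principle $\mathsf{S}_1(\mathcal{D}_\theta,\mathcal{D}_\theta)$ holds. -/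

import Mathlib

universe u

open Cardinal Topology

/-- The covering number of the ideal of meager sets: the least cardinality of a family of meager
subsets of the real line whose union is the whole real line. -/
noncomputable def covMeager : Cardinal.{0} :=
  sInf {c | ∃ F : Set (Set ℝ), (∀ s ∈ F, IsMeagre s) ∧ ⋃₀ F = Set.univ ∧ #F = c}

/-- The `θ`-closure of `A`: the points all of whose neighborhoods have a closure that meets `A`. -/
def thetaClosure {X : Type u} [TopologicalSpace X] (A : Set X) : Set X :=
  {x | ∀ U ∈ 𝓝 x, (closure U ∩ A).Nonempty}

/-- `D` is `θ`-dense when its `θ`-closure is the whole space. -/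
def IsThetaDense {X : Type u} [TopologicalSpace X] (D : Set X) : Prop :=
  thetaClosure D = Set.univ

/-- The family of all `θ`-dense subsets of `X`. -/
def thetaDenseSets (X : Type u) [TopologicalSpace X] : Set (Set X) :=
  {D | IsThetaDense D}

/-- A `θ-π`-base: a family of nonempty open sets such that the closure of every nonempty open set
contains a member of the family. -/
def IsThetaPiBase {X : Type u} [TopologicalSpace X] (V : Set (Set X)) : Prop :=
  (∀ v ∈ V, IsOpen v ∧ v.Nonempty) ∧
    ∀ U : Set X, IsOpen U → U.Nonempty → ∃ v ∈ V, v ⊆ closure U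

/-- The cardinal function `π_θ`: the least cardinality of a `θ-π`-base. -/
noncomputable def thetaPiWeight (X : Type u) [TopologicalSpace X] : Cardinal.{u} :=
  sInf {c | ∃ V : Set (Set X), IsThetaPiBase V ∧ #V = c}

/-- The cardinal function `δ_θ`: the least infinite cardinal `c` such that every `θ`-dense set
contains a `θ`-dense set of cardinality at most `c`. -/
noncomputable def thetaDensity (X : Type u) [TopologicalSpace X] : Cardinal.{u} :=
  sInf {c | ℵ₀ ≤ c ∧
    ∀ D : Set X, IsThetaDense D → ∃ C : Set X, C ⊆ D ∧ IsThetaDense C ∧ #C ≤ c}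

/-- The selection principle `S₁(𝒜, ℬ)`. -/
def SelectionOne {α : Type u} (𝒜 ℬ : Set (Set α)) : Prop :=
  ∀ A : ℕ → Set α, (∀ n, A n ∈ 𝒜) →
    ∃ b : ℕ → α, (∀ n, b n ∈ A n) ∧ Set.range b ∈ ℬ

/-- A strategy for ONE in the game `G₁(𝒜, ℬ)`: it assigns a member of `𝒜`, the next move of ONE,
to each finite sequence of previous moves of TWO (listed in chronological order). -/
def StrategyOne {α : Type u} (𝒜 : Set (Set α)) : Type u :=
  List α → 𝒜

/-- `x` is the sequence of moves of TWO in an infinite play of `G₁(𝒜, ℬ)` in which ONE uses the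
strategy `σ`: in each inning `n`, TWO picks a point of the set that `σ` chooses in response to
`x 0, …, x (n - 1)`. -/
def StrategyOne.IsPlay {α : Type u} {𝒜 : Set (Set α)} (σ : StrategyOne 𝒜) (x : ℕ → α) : Prop :=
  ∀ n : ℕ, x n ∈ (σ ((List.range n).map x)).1

/-- A strategy for ONE is winning in `G₁(𝒜, ℬ)` when ONE wins every play in which it is used, i.e.
the points picked by TWO never form a member of `ℬ`. -/
def StrategyOne.IsWinning {α : Type u} {𝒜 : Set (Set α)} (σ : StrategyOne 𝒜)
    (ℬ : Set (Set α)) : Prop :=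
  ∀ x : ℕ → α, σ.IsPlay x → Set.range x ∉ ℬ

/-- ONE has a winning strategy in the game `G₁(𝒜, ℬ)`. -/
def OneHasWinningStrategy {α : Type u} (𝒜 ℬ : Set (Set α)) : Prop :=
  ∃ σ : StrategyOne 𝒜, σ.IsWinning ℬ

/-!
The link between the three statements is a combinatorial property of `κ`, `GuessesFamilies`: every
family of at most `κ` functions `ℕ → ℕ` is guessed by one function, that is, it agrees at least once
with each member of the family. By a theorem of Bartoszyński this is equivalent to `κ < cov(ℳ)`.

If `κ < cov(ℳ)`, there is a sequence `g` that is Cohen generic for `κ` many given tasks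
(`exists_generic_nat`): coding sequences by binary digits of reals, the reals that fail one task
form a nowhere dense set. Given a strategy of ONE, `δ_θ = ℵ₀` allows the moves of ONE to be shrunk
to countable sets, so that the answers of TWO are natural numbers. For a member `v` of a
`θ-π`-base and a position of the game, some answer lies in `closure v`; a sequence generic for these
`κ` many tasks is a play whose range meets the closure of every `v`, and TWO wins it
(`not_oneHasWinningStrategy_of_lt_covMeager`).

For the way back, a family `f` of `κ` functions is turned into a countable space
(`GuessingSpace`). Its points lie in columns `n : ℕ`, and a point of column `n` makes finitely many
guesses about values of the functions, at places reserved for that column. Let the sets `H i` of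
points with a right guess about `f i` be clopen and add the cofinite topology. When distinct
functions are eventually different, finitely many of them can be guessed rightly while finitely many
others are guessed wrongly, so every column is dense. A `θ`-dense selector of the columns meets each
`H i`, and as the columns use disjoint sets of places, its guesses together form one function that
guesses the whole family (`guessesFamilies_of_selectionOne`).

Guessing then yields `κ < cov(ℳ)` (`GuessesFamilies.lt_covMeager`). It provides an interval
partition of `ℕ` such that, for each of `κ` many nowhere dense sets `N i`, infinitely many intervals
carry a block of binary digits that keeps a real number out of `N i` whatever its earlier digits
are. It also guesses partial functions with infinite domains, hence one of these blocks for every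
`i` at once; the real number composed of the guessed blocks lies in no `N i`.
-/

/-! ### Dyadic intervals -/

/-- Inside a nonempty open set there are closed dyadic intervals of every sufficiently fine level. -/
theorem exists_dyadic_Icc_subset {U : Set ℝ} (hU : IsOpen U) (hne : U.Nonempty) :
    ∃ M : ℕ, ∀ m ≥ M, ∃ a : ℤ,
      Set.Icc ((a : ℝ) / 2 ^ m) (((a : ℝ) + 1) / 2 ^ m) ⊆ U := by
  obtain ⟨x, hx⟩ := hne
  obtain ⟨ε, hε, hball⟩ := Metric.isOpen_iff.1 hU x hx
  obtain ⟨M, hM⟩ := exists_pow_lt_of_lt_one hε (by norm_num : (1 / 2 : ℝ) < 1)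
  refine ⟨M, fun m hm => ⟨⌊2 ^ m * x⌋, fun y hy => hball ?_⟩⟩
  have h2 : (0 : ℝ) < 2 ^ m := by positivity
  have hlen : 1 / (2 : ℝ) ^ m < ε := by
    refine lt_of_le_of_lt ?_ hM
    rw [← one_div_pow]
    exact pow_le_pow_of_le_one (by norm_num) (by norm_num) hm
  obtain ⟨hy1, hy2⟩ := hy
  rw [div_le_iff₀ h2] at hy1
  rw [le_div_iff₀ h2] at hy2
  have hx1 := Int.floor_le (2 ^ m * x)
  have hx2 := Int.lt_floor_add_one (2 ^ m * x)
  rw [div_lt_iff₀ h2] at hlen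
  rw [Metric.mem_ball, Real.dist_eq, abs_lt]
  constructor
  · by_contra! h
    have := mul_le_mul_of_nonneg_right h h2.le
    nlinarith
  · by_contra! h
    have := mul_le_mul_of_nonneg_right h h2.le
    nlinarith

/-- The level-`m` dyadic cell of a real number determines its coarser cells. -/
theorem floor_two_pow_mul_eq_of_le {x y : ℝ} {k m : ℕ} (hkm : k ≤ m)
    (h : ⌊2 ^ m * x⌋ = ⌊2 ^ m * y⌋) : ⌊2 ^ k * x⌋ = ⌊2 ^ k * y⌋ := by
  have key : ∀ z : ℝ, ⌊2 ^ k * z⌋ = ⌊2 ^ m * z⌋ / ((2 ^ (m - k) : ℕ) : ℤ) := by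
    intro z
    rw [← Int.floor_div_natCast]
    congr 1
    obtain ⟨d, rfl⟩ := Nat.exists_eq_add_of_le hkm
    rw [Nat.add_sub_cancel_left, pow_add]
    push_cast
    field_simp
  rw [key, key, h]

/-! ### Generic points from few meager sets -/

/-- The binary digits of a real number: digit `k` is the parity of `⌊2 ^ k * r⌋`. -/
noncomputable def binaryDigit (r : ℝ) (k : ℕ) : Bool := decide (⌊2 ^ k * r⌋ % 2 = 1)

/-- Below any dyadic cell, the digits beyond its level can be prescribed freely. -/
theorem exists_floor_binaryDigit_eq (t : ℕ → Bool) (m : ℕ) (a : ℤ)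
    (h : ∀ r : ℝ, ⌊2 ^ m * r⌋ = a → ∀ k ≤ m, binaryDigit r k = t k) (l : ℕ) :
    ∃ b : ℤ, ∀ r : ℝ, ⌊2 ^ (m + l) * r⌋ = b →
      ⌊2 ^ m * r⌋ = a ∧ ∀ k ≤ m + l, binaryDigit r k = t k := by
  induction l with
  | zero => exact ⟨a, fun r hr => ⟨hr, h r hr⟩⟩
  | succ l ih =>
    obtain ⟨b, hb⟩ := ih
    refine ⟨2 * b + if t (m + (l + 1)) then 1 else 0, fun r hr => ?_⟩
    have hcoarse : ⌊2 ^ (m + l) * r⌋ = b := by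
      rw [Int.floor_eq_iff] at hr ⊢
      rw [← add_assoc, pow_succ] at hr
      split_ifs at hr <;> push_cast at hr <;> constructor <;> linarith [hr.1, hr.2]
    obtain ⟨h1, h2⟩ := hb r hcoarse
    refine ⟨h1, fun k hk => ?_⟩
    rcases Nat.lt_or_ge (m + l) k with hlt | hle
    · obtain rfl : k = m + (l + 1) := by omega
      rw [binaryDigit, hr]
      cases t (m + (l + 1)) <;> simp
    · exact h2 k hle

/-- Fewer than `cov(ℳ)` many dense requirements on a binary sequence, each of them decided by a
finite initial segment, can be met simultaneously. -/
theorem exists_generic_bool {κ : Cardinal.{u}} (hκ : κ < Cardinal.lift.{u} covMeager)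
    {ι : Type u} (hι : #ι ≤ κ) (E : ι → Set (ℕ → Bool))
    (hE : ∀ i, ∀ (t : ℕ → Bool) (m : ℕ), ∃ t' : ℕ → Bool, (∀ k < m, t' k = t k) ∧
      ∃ M, ∀ b : ℕ → Bool, (∀ k < M, b k = t' k) → b ∈ E i) :
    ∃ b, ∀ i, b ∈ E i := by
  by_contra! hcon
  let N : ι → Set ℝ := fun i => {r | binaryDigit r ∉ E i}
  have hN : ∀ i, IsMeagre (N i) := by
    intro i
    refine IsNowhereDense.isMeagre ?_
    rw [IsNowhereDense, ← Set.not_nonempty_iff_eq_empty]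
    intro hne
    obtain ⟨M, hM⟩ := exists_dyadic_Icc_subset isOpen_interior hne
    obtain ⟨a, ha⟩ := hM M le_rfl
    obtain ⟨t', ht', L, hL⟩ := hE i (binaryDigit ((a : ℝ) / 2 ^ M)) (M + 1)
    have hcell : ∀ r : ℝ, ⌊2 ^ M * r⌋ = a → ∀ k ≤ M, binaryDigit r k = t' k := by
      intro r hr k hk
      rw [ht' k (by omega), binaryDigit, binaryDigit, floor_two_pow_mul_eq_of_le hk]
      rw [hr, mul_div_cancel₀ _ (by positivity), Int.floor_intCast]
    obtain ⟨b, hb⟩ := exists_floor_binaryDigit_eq t' M a hcell L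
    have h2 : (0 : ℝ) < 2 ^ (M + L) := by positivity
    have hmid : ((b : ℝ) + 1 / 2) / 2 ^ (M + L) ∈
        Set.Ioo ((b : ℝ) / 2 ^ (M + L)) ((b + 1) / 2 ^ (M + L)) :=
      ⟨by gcongr; linarith, by gcongr; norm_num⟩
    have hsub : ∀ r ∈ Set.Ioo ((b : ℝ) / 2 ^ (M + L)) ((b + 1) / 2 ^ (M + L)),
        ⌊2 ^ (M + L) * r⌋ = b := by
      rintro r ⟨hr1, hr2⟩
      rw [div_lt_iff₀ h2] at hr1
      rw [lt_div_iff₀ h2] at hr2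
      rw [Int.floor_eq_iff]
      constructor <;> linarith
    have hcl : ((b : ℝ) + 1 / 2) / 2 ^ (M + L) ∈ closure (N i) := by
      refine interior_subset (ha ?_)
      have h2M : (0 : ℝ) < 2 ^ M := by positivity
      have := (hb _ (hsub _ hmid)).1
      rw [Int.floor_eq_iff] at this
      rw [Set.mem_Icc, div_le_iff₀ h2M, le_div_iff₀ h2M]
      constructor <;> linarith [this.1, this.2]
    obtain ⟨r, hrI, hrN⟩ := mem_closure_iff.1 hcl _ isOpen_Ioo hmid
    exact hrN (hL _ fun k hk => (hb r (hsub r hrI)).2 k (by omega))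
  have hcov : covMeager ≤ #(Set.range N) := by
    refine csInf_le' ⟨Set.range N, ?_, ?_, rfl⟩
    · rintro _ ⟨i, rfl⟩
      exact hN i
    · refine Set.eq_univ_of_forall fun r => ?_
      obtain ⟨i, hi⟩ := hcon (binaryDigit r)
      exact ⟨N i, ⟨i, rfl⟩, hi⟩
  have h1 : Cardinal.lift.{u} #(Set.range N) ≤ #ι := by
    simpa using mk_range_le_lift (f := N)
  exact absurd (hκ.trans_le ((Cardinal.lift_le.2 hcov).trans (h1.trans hι))) (lt_irrefl _)

/-- The minimum of a set of natural numbers depends only on an initial segment meeting it. -/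
theorem sInf_setOf_congr {p q : ℕ → Prop} {m : ℕ} (hm : p m) (h : ∀ j ≤ m, (p j ↔ q j)) :
    sInf {j | p j} = sInf {j | q j} := by
  have hp : p (sInf {j | p j}) := Nat.sInf_mem (s := {j | p j}) ⟨m, hm⟩
  have hq : q (sInf {j | q j}) := Nat.sInf_mem (s := {j | q j}) ⟨m, (h m le_rfl).1 hm⟩
  have hpm : sInf {j | p j} ≤ m := Nat.sInf_le hm
  have hqm : sInf {j | q j} ≤ m := Nat.sInf_le (s := {j | q j}) ((h m le_rfl).1 hm)
  exact le_antisymm (Nat.sInf_le (s := {j | p j}) ((h _ hqm).2 hq))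
    (Nat.sInf_le (s := {j | q j}) ((h _ hpm).1 hp))

/-- Cohen genericity: for fewer than `cov(ℳ)` many functions `f i` predicting the next value of a
sequence from its finite past, some sequence obeys each of them at least once. -/
theorem exists_generic_nat {κ : Cardinal.{u}} (hκ : κ < Cardinal.lift.{u} covMeager)
    {ι : Type u} (hι : #ι ≤ κ) (f : ι → List ℕ → ℕ) :
    ∃ g : ℕ → ℕ, ∀ i, ∃ n, g n = f i ((List.range n).map g) := by
  classical
  -- A binary matrix `b` codes the sequence whose `n`-th term is the first `1` in row `n`.
  let dec : (ℕ → Bool) → ℕ → ℕ := fun b n => sInf {j | b (Nat.pair n j) = true}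
  obtain ⟨b, hb⟩ := exists_generic_bool hκ hι
    (fun i => {b | ∃ n, dec b n = f i ((List.range n).map (dec b))}) (by
    intro i t m
    -- The first `m` entries lie in rows below `m`, so row `m` is still untouched; close all
    -- earlier rows by ones, and then put into row `m` the value that `f i` predicts.
    let K : ℕ := f i ((List.range m).map (dec fun k => if k < m then t k else true))
    let t' : ℕ → Bool := fun k => if k < m then t k else
      if k.unpair.1 < m then true else decide (k.unpair.2 = K)
    refine ⟨t', fun k hk => if_pos hk, Nat.pair m (max m K) + 1, fun b hb => ⟨m, ?_⟩⟩
    have hmono : ∀ n ≤ m, ∀ j ≤ max m K, Nat.pair n j < Nat.pair m (max m K) + 1 := by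
      intro n hn j hj
      have h1 : Nat.pair n j ≤ Nat.pair m j := by
        rcases hn.eq_or_lt with rfl | h
        · exact le_rfl
        · exact (Nat.pair_lt_pair_left j h).le
      have h2 : Nat.pair m j ≤ Nat.pair m (max m K) := by
        rcases hj.eq_or_lt with h | h
        · rw [h]
        · exact (Nat.pair_lt_pair_right m h).le
      omega
    have hrow : dec b m = K := by
      have hval : ∀ j ≤ max m K, b (Nat.pair m j) = decide (j = K) := by
        intro j hj
        rw [hb _ (hmono m le_rfl j hj)]
        have := Nat.left_le_pair m j
        simp [t', Nat.not_lt.2 this]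
      have h1 : dec b m = sInf {j | j = K} := by
        refine (sInf_setOf_congr (p := fun j => j = K) (m := K) rfl fun j hj => ?_).symm
        rw [hval j (hj.trans (le_max_right _ _))]
        simp
      rw [h1]
      simp
    rw [hrow]
    change f i _ = f i _
    congr 1
    refine List.map_congr_left fun n hn => ?_
    have hn : n < m := List.mem_range.1 hn
    refine sInf_setOf_congr (m := m) ?_ fun j hj => ?_
    · simp [Nat.not_lt.2 (Nat.right_le_pair n m)]
    · rw [hb _ (hmono n hn.le j (hj.trans (le_max_left _ _)))]
      simp [t', hn])
  exact ⟨dec b, hb⟩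

/-! ### Theta-dense sets -/

theorem isThetaDense_iff {X : Type u} [TopologicalSpace X] {D : Set X} :
    IsThetaDense D ↔ ∀ U : Set X, IsOpen U → U.Nonempty → (closure U ∩ D).Nonempty := by
  rw [IsThetaDense, Set.eq_univ_iff_forall]
  constructor
  · rintro h U hU ⟨x, hx⟩
    exact h x U (hU.mem_nhds hx)
  · intro h x U hU
    obtain ⟨V, hVU, hV, hxV⟩ := mem_nhds_iff.1 hU
    exact (h V hV ⟨x, hxV⟩).mono (by gcongr)

theorem IsThetaPiBase.isThetaDense {X : Type u} [TopologicalSpace X] {V : Set (Set X)}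
    (hV : IsThetaPiBase V) {D : Set X} (hD : ∀ v ∈ V, (closure v ∩ D).Nonempty) :
    IsThetaDense D := by
  refine isThetaDense_iff.2 fun U hU hne => ?_
  obtain ⟨v, hv, hvU⟩ := hV.2 U hU hne
  exact (hD v hv).mono (Set.inter_subset_inter_left _ (closure_minimal hvU isClosed_closure))

theorem exists_isThetaPiBase_mk_eq (X : Type u) [TopologicalSpace X] :
    ∃ V : Set (Set X), IsThetaPiBase V ∧ #V = thetaPiWeight X := by
  refine csInf_mem (s := {c | ∃ V : Set (Set X), IsThetaPiBase V ∧ #V = c})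
    ⟨_, {v | IsOpen v ∧ v.Nonempty},
      ⟨fun v hv => hv, fun U hU hne => ?_⟩, rfl⟩
  exact ⟨U, ⟨hU, hne⟩, subset_closure⟩

theorem exists_countable_isThetaDense {X : Type u} [TopologicalSpace X]
    (hX : thetaDensity X = ℵ₀) {D : Set X} (hD : IsThetaDense D) :
    ∃ C ⊆ D, IsThetaDense C ∧ C.Countable := by
  have hmem : thetaDensity X ∈ {c | ℵ₀ ≤ c ∧
      ∀ D : Set X, IsThetaDense D → ∃ C : Set X, C ⊆ D ∧ IsThetaDense C ∧ #C ≤ c} :=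
    csInf_mem ⟨max ℵ₀ #X, le_max_left _ _, fun D hD =>
      ⟨D, subset_rfl, hD, (mk_set_le D).trans (le_max_right _ _)⟩⟩
  obtain ⟨C, hCD, hC, hcard⟩ := hmem.2 D hD
  exact ⟨C, hCD, hC, le_aleph0_iff_set_countable.1 (hX ▸ hcard)⟩

/-- In a countable space, `δ_θ` is as small as possible. -/
theorem thetaDensity_eq_aleph0 (X : Type u) [TopologicalSpace X] [Countable X] :
    thetaDensity X = ℵ₀ := by
  have hmem : ℵ₀ ∈ {c : Cardinal.{u} | ℵ₀ ≤ c ∧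
      ∀ D : Set X, IsThetaDense D → ∃ C : Set X, C ⊆ D ∧ IsThetaDense C ∧ #C ≤ c} :=
    ⟨le_rfl, fun D hD => ⟨D, subset_rfl, hD, mk_le_aleph0⟩⟩
  exact le_antisymm (csInf_le' hmem) (le_csInf ⟨_, hmem⟩ fun c hc => hc.1)

/-! ### The game below the covering number -/

/-- TWO defeats any strategy of ONE: after the moves of ONE have been shrunk to countable sets, the
plays are coded by sequences of natural numbers, and a sequence that is generic for one prediction
function per member of a small `θ-π`-base codes a play whose range is `θ`-dense. -/
theorem not_oneHasWinningStrategy_of_lt_covMeager {κ : Cardinal.{u}}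
    (hκ : κ < Cardinal.lift.{u} covMeager) (X : Type u) [TopologicalSpace X] [Nonempty X]
    (hδ : thetaDensity X = ℵ₀) (hπ : thetaPiWeight X ≤ κ) :
    ¬ OneHasWinningStrategy (thetaDenseSets X) (thetaDenseSets X) := by
  rintro ⟨σ, hσ⟩
  have henum : ∀ s : List X, ∃ d : ℕ → X, (∀ k, d k ∈ (σ s).1) ∧ IsThetaDense (Set.range d) := by
    intro s
    obtain ⟨C, hC, hCd, hcount⟩ := exists_countable_isThetaDense hδ (σ s).2
    obtain ⟨y, -, hy⟩ := isThetaDense_iff.1 hCd Set.univ isOpen_univ Set.univ_nonempty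
    obtain ⟨d, rfl⟩ := hcount.exists_eq_range ⟨y, hy⟩
    exact ⟨d, fun k => hC ⟨k, rfl⟩, hCd⟩
  choose d hdσ hdd using henum
  obtain ⟨V, hV, hVcard⟩ := exists_isThetaPiBase_mk_eq X
  have hhit : ∀ (v : V) (s : List X), ∃ k, d s k ∈ closure v.1 := by
    intro v s
    obtain ⟨hvo, hvne⟩ := hV.1 v.1 v.2
    obtain ⟨_, hy, k, rfl⟩ := isThetaDense_iff.1 (hdd s) v.1 hvo hvne
    exact ⟨k, hy⟩
  choose F hF using hhit
  -- `pos l` lists the points that TWO has picked when her choices had the indices in `l`.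
  let pos : List ℕ → List X := fun l => l.foldl (fun s k => s ++ [d s k]) []
  obtain ⟨g, hg⟩ := exists_generic_nat hκ (hVcard.le.trans hπ) fun v l => F v (pos l)
  let x : ℕ → X := fun n => d (pos ((List.range n).map g)) (g n)
  have hx : ∀ n, (List.range n).map x = pos ((List.range n).map g) := by
    intro n
    induction n with
    | zero => rfl
    | succ n ih =>
      rw [List.range_succ, List.map_append, ih]
      simp [pos, x]
  refine hσ x (fun n => ?_) (hV.isThetaDense fun v hv => ?_)
  · rw [hx]
    exact hdσ _ _
  · obtain ⟨n, hn⟩ := hg ⟨v, hv⟩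
    refine ⟨x n, ?_, n, rfl⟩
    change d _ (g n) ∈ _
    rw [hn]
    exact hF ⟨v, hv⟩ _

/-- A sequence of sets is a strategy of ONE that ignores the moves of TWO. -/
theorem selectionOne_of_not_oneHasWinningStrategy {α : Type u} {𝒜 ℬ : Set (Set α)}
    (h : ¬ OneHasWinningStrategy 𝒜 ℬ) : SelectionOne 𝒜 ℬ := by
  intro A hA
  by_contra hcon
  refine h ⟨fun s => ⟨A s.length, hA _⟩, fun x hx hmem => hcon ⟨x, fun n => ?_, hmem⟩⟩
  simpa using hx n

/-! ### Guessing families of functions -/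

/-- Every family of at most `κ` many functions `ℕ → ℕ` is guessed by a single function, which
agrees with each member of the family in at least one place. -/
def GuessesFamilies (κ : Cardinal.{u}) : Prop :=
  ∀ (ι : Type u), #ι ≤ κ → ∀ f : ι → ℕ → ℕ, ∃ g : ℕ → ℕ, ∀ i, ∃ n, g n = f i n

/-- Guessing gives unbounded functions, in the form of an interval partition: infinitely many of
its intervals `[n k, n (k + 1))` are long enough for `h i`. -/
theorem GuessesFamilies.exists_interval_partition {κ : Cardinal.{u}} (hκ : ℵ₀ ≤ κ)
    (hG : GuessesFamilies κ) {ι : Type u} (hι : #ι ≤ κ) (h : ι → ℕ → ℕ) :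
    ∃ n : ℕ → ℕ, StrictMono n ∧ ∀ i, {k | h i (n k) ≤ n (k + 1)}.Infinite := by
  obtain ⟨H, hH, hhH⟩ : ∃ H : ι → ℕ → ℕ, (∀ i, Monotone (H i)) ∧ ∀ i m, h i m ≤ H i m :=
    ⟨fun i => partialSups (h i), fun i => (partialSups (h i)).monotone,
      fun i => le_partialSups (h i)⟩
  have hprod : #(ι × ULift.{u} ℕ) ≤ κ := by
    rw [mk_prod, Cardinal.lift_id, Cardinal.lift_id]
    exact (mul_le_mul' hι (by simpa using hκ)).trans (mul_eq_self hκ).le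
  -- The shifts by `p.2` make the guess reach the bound at arbitrarily large arguments, and the
  -- iterate of `H` compares the value at a point with the lengths of two consecutive intervals.
  obtain ⟨g, hg⟩ := hG _ hprod fun p j => H p.1 (H p.1 (p.2.down + j))
  obtain ⟨G, hGm, hgG⟩ : ∃ G : ℕ → ℕ, Monotone G ∧ ∀ j, g j ≤ G j :=
    ⟨partialSups g, (partialSups g).monotone, le_partialSups g⟩
  obtain ⟨n, hn0, hn⟩ : ∃ n : ℕ → ℕ, n 0 = 0 ∧ ∀ k, n (k + 1) = max (n k + 1) (G (n k)) :=
    ⟨fun k => k.rec 0 fun _ r => max (r + 1) (G r), rfl, fun k => rfl⟩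
  have hmono : StrictMono n := strictMono_nat_of_lt_succ fun k => by
    rw [hn]
    exact lt_of_lt_of_le (Nat.lt_succ_self _) (le_max_left _ _)
  refine ⟨n, hmono, fun i => ?_⟩
  rw [← Nat.frequently_atTop_iff_infinite, Filter.frequently_atTop]
  intro K
  by_contra! hK
  have hlt : ∀ k ≥ K, n (k + 1) < H i (n k) := fun k hk =>
    (hK k hk).trans_le (hhH i (n k))
  obtain ⟨j, hj⟩ := hg (i, ⟨n K⟩)
  replace hj : H i (H i (n K + j)) ≤ G (n K + j) := by
    rw [← hj]
    exact (hgG j).trans (hGm (Nat.le_add_left _ _))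
  obtain ⟨k, hk1, hk2⟩ : ∃ k, n k ≤ n K + j ∧ n K + j < n (k + 1) := by
    have hex : ∃ k, n K + j < n k := ⟨n K + j + 1, hmono.id_le (n K + j + 1)⟩
    have hpos : Nat.find hex ≠ 0 := by
      intro h0
      have := Nat.find_spec hex
      rw [h0, hn0] at this
      exact Nat.not_lt_zero _ this
    obtain ⟨k, hk⟩ := Nat.exists_eq_succ_of_ne_zero hpos
    refine ⟨k, not_lt.1 (Nat.find_min hex (m := k) (by omega)), ?_⟩
    have := Nat.find_spec hex
    rwa [hk] at this
  have hKk : K ≤ k := by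
    by_contra! hlt'
    have := hmono.monotone (Nat.succ_le_of_lt hlt')
    simp only [Nat.succ_eq_add_one] at this
    omega
  have h1 : G (n K + j) ≤ n (k + 1 + 1) := by
    rw [hn (k + 1)]
    exact (hGm hk2.le).trans (le_max_right _ _)
  have h2 : n (k + 1 + 1) < H i (n (k + 1)) := hlt _ (by omega)
  have h3 : H i (n (k + 1)) ≤ H i (H i (n k)) := hH i (hlt k hKk).le
  have h4 : H i (H i (n k)) ≤ H i (H i (n K + j)) := hH i (hH i hk1)
  omega

/-- From finite sets of pairs whose `n`-th member has more than `n` first coordinates, one can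
choose a function that goes through a point of each. -/
theorem exists_function_through (P : ℕ → Finset (ℕ × ℕ)) :
    ∃ g : ℕ → ℕ, ∀ n, n < ((P n).image Prod.fst).card → ∃ q ∈ P n, g q.1 = q.2 := by
  classical
  -- `R n` collects at most `n` pairs with distinct first coordinates; there is always room for
  -- a new one from `P n`.
  let step : ℕ → Finset (ℕ × ℕ) → Finset (ℕ × ℕ) := fun n R =>
    if h : ∃ q ∈ P n, q.1 ∉ R.image Prod.fst then insert h.choose R else R
  let R : ℕ → Finset (ℕ × ℕ) := fun n => n.rec ∅ step
  have hR : ∀ n, R (n + 1) = step n (R n) := fun n => rfl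
  have hsucc : ∀ n, R n ⊆ R (n + 1) := by
    intro n
    rw [hR]
    by_cases h : ∃ q ∈ P n, q.1 ∉ (R n).image Prod.fst
    · simp only [step, dif_pos h]
      exact Finset.subset_insert _ _
    · simp only [step, dif_neg h]
      exact subset_rfl
  have hmono : Monotone R := monotone_nat_of_le_succ hsucc
  have hinv : ∀ n, (R n).card ≤ n ∧ ∀ q ∈ R n, ∀ q' ∈ R n, q.1 = q'.1 → q = q' := by
    intro n
    induction n with
    | zero => simp [R]
    | succ n ih =>
      rw [hR]
      by_cases h : ∃ q ∈ P n, q.1 ∉ (R n).image Prod.fst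
      · simp only [step, dif_pos h]
        have hnew := h.choose_spec.2
        refine ⟨(Finset.card_insert_le _ _).trans (by omega), fun q hq q' hq' hqq => ?_⟩
        rcases Finset.mem_insert.1 hq with hq | hq <;>
          rcases Finset.mem_insert.1 hq' with hq' | hq'
        · rw [hq, hq']
        · exact absurd (Finset.mem_image.2 ⟨q', hq', by rw [← hqq, hq]⟩) hnew
        · exact absurd (Finset.mem_image.2 ⟨q, hq, by rw [hqq, hq']⟩) hnew
        · exact ih.2 q hq q' hq' hqq
      · simp only [step, dif_neg h]
        exact ⟨ih.1.trans (Nat.le_succ n), ih.2⟩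
  have hfun : ∀ k, ∃ v, ∀ n, ∀ q ∈ R n, q.1 = k → v = q.2 := by
    intro k
    by_cases h : ∃ n, ∃ q ∈ R n, q.1 = k
    · obtain ⟨n, q, hq, hqk⟩ := h
      refine ⟨q.2, fun n' q' hq' hqk' => ?_⟩
      rw [(hinv (max n n')).2 q (hmono (le_max_left _ _) hq) q' (hmono (le_max_right _ _) hq')
        (hqk.trans hqk'.symm)]
    · exact ⟨0, fun n q hq hqk => absurd ⟨n, q, hq, hqk⟩ h⟩
  choose g hg using hfun
  refine ⟨g, fun n hn => ?_⟩
  have h : ∃ q ∈ P n, q.1 ∉ (R n).image Prod.fst := by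
    by_contra! hcon
    have hsub : (P n).image Prod.fst ⊆ (R n).image Prod.fst :=
      Finset.image_subset_iff.2 hcon
    have := (Finset.card_le_card hsub).trans Finset.card_image_le
    exact absurd (this.trans (hinv n).1) (not_le.2 hn)
  refine ⟨h.choose, h.choose_spec.1, hg _ (n + 1) _ ?_ rfl⟩
  rw [hR]
  simp only [step, dif_pos h]
  exact Finset.mem_insert_self _ _

/-- Guessing extends to partial functions with infinite domains `A i`: guess at stage `n` a piece
of the `i`-th function with `n + 1` points, and keep one point at which nothing has been decided. -/
theorem GuessesFamilies.exists_guess_partial {κ : Cardinal.{u}} (hG : GuessesFamilies κ)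
    {ι : Type u} (hι : #ι ≤ κ) (A : ι → Set ℕ) (hA : ∀ i, (A i).Infinite) (f : ι → ℕ → ℕ) :
    ∃ g : ℕ → ℕ, ∀ i, ∃ k ∈ A i, g k = f i k := by
  classical
  have hS : ∀ i n, ∃ S : Finset ℕ, (S : Set ℕ) ⊆ A i ∧ S.card = n + 1 := fun i n =>
    (hA i).exists_subset_card_eq (n + 1)
  choose S hSA hScard using hS
  let piece : ι → ℕ → Finset (ℕ × ℕ) := fun i n => (S i n).image fun k => (k, f i k)
  obtain ⟨G, hGuess⟩ := hG ι hι fun i n => Encodable.encode (piece i n)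
  obtain ⟨g, hg⟩ := exists_function_through fun n =>
    ((Encodable.decode (G n) : Option (Finset (ℕ × ℕ))).getD ∅)
  refine ⟨g, fun i => ?_⟩
  obtain ⟨n, hn⟩ := hGuess i
  have hgn := hg n
  rw [hn, Encodable.encodek, Option.getD_some, Finset.image_image] at hgn
  obtain ⟨q, hq, hgq⟩ := hgn (by simp [Function.comp_def, hScard])
  obtain ⟨k, hk, rfl⟩ := Finset.mem_image.1 hq
  exact ⟨k, hSA i n hk, hgq⟩

/-! ### Bartoszyński's theorem -/

/-- A number of the unit interval can be kept out of a nowhere dense set without knowledge of its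
first `n` binary digits: one block `a` of the next digits works below all `2 ^ n` dyadic
cells of level `n` simultaneously, and the block may have any sufficiently large length. -/
theorem exists_uniform_dyadic_avoiding {N : Set ℝ} (hN : IsNowhereDense N) (n : ℕ) :
    ∃ M : ℕ, ∀ m ≥ M, n ≤ m → ∃ a : ℕ, a < 2 ^ (m - n) ∧ ∀ c < 2 ^ n,
      Disjoint (Set.Icc (((c * 2 ^ (m - n) + a : ℕ) : ℝ) / 2 ^ m)
        (((c * 2 ^ (m - n) + a : ℕ) + 1 : ℝ) / 2 ^ m)) N := by
  have hopen : ∀ c : ℕ, IsOpen {y : ℝ | y + c / 2 ^ n ∉ closure N} := fun c =>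
    isClosed_closure.isOpen_compl.preimage (by fun_prop)
  have hdense : ∀ c : ℕ, Dense {y : ℝ | y + c / 2 ^ n ∉ closure N} := by
    intro c
    have hd : Dense (closure N)ᶜ := interior_eq_empty_iff_dense_compl.1 hN
    exact hd.preimage (Homeomorph.addRight ((c : ℝ) / 2 ^ n)).isOpenMap
  have hO : IsOpen (⋂ c ∈ Finset.range (2 ^ n), {y : ℝ | y + c / 2 ^ n ∉ closure N}) :=
    isOpen_biInter_finset fun c _ => hopen c
  have hD : Dense (⋂ c ∈ (Finset.range (2 ^ n) : Set ℕ), {y : ℝ | y + c / 2 ^ n ∉ closure N}) :=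
    dense_biInter_of_isOpen (fun c _ => hopen c) (Finset.countable_toSet _) fun c _ => hdense c
  have hn : (0 : ℝ) < 2 ^ n := by positivity
  obtain ⟨M, hM⟩ := exists_dyadic_Icc_subset (isOpen_Ioo.inter hO)
    (hD.inter_open_nonempty (Set.Ioo (0 : ℝ) (1 / 2 ^ n)) isOpen_Ioo
      (Set.nonempty_Ioo.2 (by positivity)))
  refine ⟨M, fun m hm hnm => ?_⟩
  obtain ⟨a, ha⟩ := hM m hm
  have hm0 : (0 : ℝ) < 2 ^ m := by positivity
  have hsplit : (2 : ℝ) ^ m = 2 ^ (m - n) * 2 ^ n := by rw [← pow_add, Nat.sub_add_cancel hnm]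
  have hle : (a : ℝ) / 2 ^ m ≤ (a + 1) / 2 ^ m := by gcongr; linarith
  have h0 : (0 : ℝ) < a := by
    have := (ha (Set.left_mem_Icc.2 hle)).1.1
    rwa [lt_div_iff₀ hm0, zero_mul] at this
  have h1 : (a : ℝ) + 1 < 2 ^ (m - n) := by
    have := (ha (Set.right_mem_Icc.2 hle)).1.2
    rwa [div_lt_div_iff₀ hm0 hn, one_mul, hsplit, mul_lt_mul_iff_left₀ hn] at this
  lift a to ℕ using by exact_mod_cast h0.le
  rw [Int.cast_natCast] at ha h1
  refine ⟨a, by exact_mod_cast (lt_add_one (a : ℝ)).trans h1, fun c hc => ?_⟩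
  have hc' : (c : ℝ) / 2 ^ n = c * 2 ^ (m - n) / 2 ^ m := by
    rw [hsplit]
    field_simp
  rw [Set.disjoint_left]
  rintro y ⟨hy1, hy2⟩ hyN
  push_cast at hy1 hy2
  have hmem := (ha (show y - c / 2 ^ n ∈ _ by
    rw [hc']
    constructor
    · rw [le_sub_iff_add_le, ← add_div, add_comm]
      exact hy1
    · rw [sub_le_iff_le_add, ← add_div]
      exact hy2.trans_eq (by ring))).2
  have := Set.mem_iInter₂.1 hmem c (Finset.mem_range.2 hc)
  simp only [Set.mem_ofPred_eq, sub_add_cancel] at this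
  exact this (subset_closure hyN)

/-- A real number whose binary expansion has prescribed digit blocks: block `k` occupies the places
from `n k` to `n (k + 1)`, and `x` lies in the dyadic cell that the first blocks determine. -/
theorem exists_real_of_blocks {n : ℕ → ℕ} (hn : StrictMono n) (a : ℕ → ℕ)
    (ha : ∀ k, a k < 2 ^ (n (k + 1) - n k)) :
    ∃ x : ℝ, ∀ k, ∃ c < 2 ^ n k,
      x ∈ Set.Icc (((c * 2 ^ (n (k + 1) - n k) + a k : ℕ) : ℝ) / 2 ^ n (k + 1))
        (((c * 2 ^ (n (k + 1) - n k) + a k : ℕ) + 1 : ℝ) / 2 ^ n (k + 1)) := by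
  obtain ⟨c, hc0, hc⟩ : ∃ c : ℕ → ℕ, c 0 = 0 ∧
      ∀ k, c (k + 1) = c k * 2 ^ (n (k + 1) - n k) + a k :=
    ⟨fun k => k.rec 0 fun k r => r * 2 ^ (n (k + 1) - n k) + a k, rfl, fun k => rfl⟩
  have hpow : ∀ k, 2 ^ n (k + 1) = 2 ^ n k * 2 ^ (n (k + 1) - n k) := fun k => by
    rw [← pow_add, Nat.add_sub_cancel' (hn (Nat.lt_succ_self k)).le]
  have hlt : ∀ k, c k < 2 ^ n k := by
    intro k
    induction k with
    | zero => simp [hc0]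
    | succ k ih =>
      rw [hc, hpow]
      calc c k * 2 ^ (n (k + 1) - n k) + a k
          < c k * 2 ^ (n (k + 1) - n k) + 2 ^ (n (k + 1) - n k) := by gcongr; exact ha k
        _ = (c k + 1) * 2 ^ (n (k + 1) - n k) := by ring
        _ ≤ _ := by gcongr; exact ih
  let I : ℕ → Set ℝ := fun k => Set.Icc ((c k : ℝ) / 2 ^ n k) ((c k + 1 : ℝ) / 2 ^ n k)
  have hnest : ∀ k, I (k + 1) ⊆ I k := by
    intro k
    have hpowR : (2 : ℝ) ^ n (k + 1) = 2 ^ n k * 2 ^ (n (k + 1) - n k) := by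
      exact_mod_cast hpow k
    have haR : (a k : ℝ) + 1 ≤ 2 ^ (n (k + 1) - n k) := by exact_mod_cast ha k
    apply Set.Icc_subset_Icc
    · rw [div_le_div_iff₀ (by positivity) (by positivity), hpowR, hc]
      push_cast
      have : (0 : ℝ) ≤ a k * 2 ^ n k := by positivity
      linarith
    · rw [div_le_div_iff₀ (by positivity) (by positivity), hpowR, hc]
      push_cast
      have : ((a k : ℝ) + 1) * 2 ^ n k ≤ 2 ^ (n (k + 1) - n k) * 2 ^ n k := by gcongr
      linarith
  have hne : ∀ k, (I k).Nonempty := fun k => Set.nonempty_Icc.2 (by gcongr; linarith)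
  obtain ⟨x, hx⟩ := IsCompact.nonempty_iInter_of_sequence_nonempty_isCompact_isClosed I hnest hne
    isCompact_Icc fun k => isClosed_Icc
  refine ⟨x, fun k => ⟨c k, hlt k, ?_⟩⟩
  rw [← hc]
  exact Set.mem_iInter.1 hx (k + 1)

/-- The reals are not covered by `κ` many nowhere dense sets when families of size `κ` can be
guessed: guess, on a suitable interval partition, the blocks of digits that avoid each of them. -/
theorem GuessesFamilies.exists_notMem_nowhereDense {κ : Cardinal.{u}} (hκ : ℵ₀ ≤ κ)
    (hG : GuessesFamilies κ) {ι : Type u} (hι : #ι ≤ κ) (N : ι → Set ℝ)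
    (hN : ∀ i, IsNowhereDense (N i)) : ∃ x, ∀ i, x ∉ N i := by
  classical
  choose h hh using fun i n => exists_uniform_dyadic_avoiding (hN i) n
  obtain ⟨n, hn, hinf⟩ := hG.exists_interval_partition hκ hι h
  have hblock : ∀ i k, ∃ a : ℕ, h i (n k) ≤ n (k + 1) → a < 2 ^ (n (k + 1) - n k) ∧
      ∀ c < 2 ^ n k, Disjoint
        (Set.Icc (((c * 2 ^ (n (k + 1) - n k) + a : ℕ) : ℝ) / 2 ^ n (k + 1))
          (((c * 2 ^ (n (k + 1) - n k) + a : ℕ) + 1 : ℝ) / 2 ^ n (k + 1))) (N i) := by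
    intro i k
    by_cases hk : h i (n k) ≤ n (k + 1)
    · obtain ⟨a, ha⟩ := hh i (n k) (n (k + 1)) hk (hn (Nat.lt_succ_self k)).le
      exact ⟨a, fun _ => ha⟩
    · exact ⟨0, fun hk' => absurd hk' hk⟩
  choose a ha using hblock
  obtain ⟨g, hg⟩ := hG.exists_guess_partial hι _ hinf a
  obtain ⟨x, hx⟩ := exists_real_of_blocks hn
    (fun k => if g k < 2 ^ (n (k + 1) - n k) then g k else 0) (fun k => by
      split_ifs with hk
      · exact hk
      · exact Nat.two_pow_pos _)
  refine ⟨x, fun i hxi => ?_⟩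
  obtain ⟨k, hk, hgk⟩ := hg i
  obtain ⟨hak, hdisj⟩ := ha i k hk
  obtain ⟨c, hc, hxc⟩ := hx k
  rw [hgk, if_pos hak] at hxc
  exact Set.disjoint_left.1 (hdisj c hc) hxc hxi

/-- The nontrivial half of Bartoszyński's characterization of `cov(ℳ)`. -/
theorem GuessesFamilies.lt_covMeager {κ : Cardinal.{u}} (hκ : ℵ₀ ≤ κ)
    (hG : GuessesFamilies κ) : κ < Cardinal.lift.{u} covMeager := by
  by_contra! hle
  obtain ⟨F, hF, hcover, hcard⟩ := csInf_mem
    (s := {c | ∃ F : Set (Set ℝ), (∀ s ∈ F, IsMeagre s) ∧ ⋃₀ F = Set.univ ∧ #F = c})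
    ⟨_, Set.range fun x : ℝ => {x}, by
      rintro _ ⟨x, rfl⟩
      exact IsNowhereDense.isMeagre (by simp [IsNowhereDense]), by
      rw [Set.sUnion_range]
      exact Set.iUnion_of_singleton ℝ, rfl⟩
  have hnd : ∀ s : F, ∃ T : ℕ → Set ℝ, (∀ n, IsNowhereDense (T n)) ∧ s.1 ⊆ ⋃ n, T n := by
    intro s
    obtain ⟨S, hS, hScount, hsub⟩ := isMeagre_iff_countable_union_isNowhereDense.1 (hF s.1 s.2)
    obtain ⟨T, hT⟩ := (hScount.insert ∅).exists_eq_range (Set.insert_nonempty _ _)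
    refine ⟨T, fun n => ?_, fun x hx => ?_⟩
    · have hmem : T n ∈ insert ∅ S := hT ▸ ⟨n, rfl⟩
      rcases Set.mem_insert_iff.1 hmem with h | h
      · rw [h]
        exact isNowhereDense_empty
      · exact hS _ h
    · obtain ⟨t, ht, hxt⟩ := hsub hx
      obtain ⟨n, rfl⟩ : t ∈ Set.range T := hT ▸ Set.mem_insert_of_mem _ ht
      exact Set.mem_iUnion.2 ⟨n, hxt⟩
  choose T hT hTsub using hnd
  have hι : #(ULift.{u} F × ULift.{u} ℕ) ≤ κ := by
    rw [mk_prod, Cardinal.lift_id, Cardinal.lift_id, mk_uLift, hcard]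
    exact (mul_le_mul' hle (by simpa using hκ)).trans (mul_eq_self hκ).le
  obtain ⟨x, hx⟩ := hG.exists_notMem_nowhereDense hκ hι (fun p => T p.1.down p.2.down)
    fun p => hT _ _
  obtain ⟨s, hs, hxs⟩ : x ∈ ⋃₀ F := hcover ▸ Set.mem_univ x
  obtain ⟨n, hn⟩ := Set.mem_iUnion.1 (hTsub ⟨s, hs⟩ hxs)
  exact hx (⟨⟨s, hs⟩⟩, ⟨n⟩) hn

/-! ### The guessing space -/

/-- The points of the guessing space of a family `f : ι → ℕ → ℕ → ℕ`. A point `(n, p, k)` lies in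
the column `n`; the finitely supported `p` makes finitely many guesses about the function
`f i n`, the value `p j = m + 1` standing for the guess `f i n j = m` and the value `p j = 0` for
no guess. The last coordinate is a mere multiplicity. -/
def GuessingSpace {ι : Type u} (_f : ι → ℕ → ℕ → ℕ) : Type u :=
  ULift.{u} (ℕ × (ℕ →₀ ℕ) × ℕ)

namespace GuessingSpace

variable {ι : Type u} {f : ι → ℕ → ℕ → ℕ}

/-- The column of a point. -/
def column (x : GuessingSpace f) : ℕ := x.down.1

/-- The guesses that a point makes. -/
def guesses (x : GuessingSpace f) : ℕ →₀ ℕ := x.down.2.1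

/-- One of the guesses made by `x` is right for the index `i`. -/
def Hits (x : GuessingSpace f) (i : ι) : Prop :=
  ∃ j, x.guesses j = f i x.column j + 1

/-- The basic open sets: the points outside the finite set `T` that hit the same indices in the
finite set `S` as `x` does. -/
def cell (S : Finset ι) (T : Finset (GuessingSpace f)) (x : GuessingSpace f) :
    Set (GuessingSpace f) :=
  {y | y ∉ T ∧ ∀ i ∈ S, (y.Hits i ↔ x.Hits i)}

/-- The coarsest topology in which all sets `{x | x.Hits i}` are clopen and finite sets are
closed. -/
instance : TopologicalSpace (GuessingSpace f) where
  IsOpen U := ∀ x ∈ U, ∃ S T, x ∉ T ∧ cell S T x ⊆ U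
  isOpen_univ x _ := ⟨∅, ∅, Finset.notMem_empty x, Set.subset_univ _⟩
  isOpen_inter U V hU hV x hx := by
    classical
    obtain ⟨S, T, hT, hST⟩ := hU x hx.1
    obtain ⟨S', T', hT', hST'⟩ := hV x hx.2
    refine ⟨S ∪ S', T ∪ T', by simp [hT, hT'], fun y hy => ⟨hST ⟨?_, ?_⟩, hST' ⟨?_, ?_⟩⟩⟩
    · exact fun h => hy.1 (Finset.mem_union_left _ h)
    · exact fun i hi => hy.2 i (Finset.mem_union_left _ hi)
    · exact fun h => hy.1 (Finset.mem_union_right _ h)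
    · exact fun i hi => hy.2 i (Finset.mem_union_right _ hi)
  isOpen_sUnion 𝒰 h𝒰 x := by
    rintro ⟨U, hU, hx⟩
    obtain ⟨S, T, hT, hST⟩ := h𝒰 U hU x hx
    exact ⟨S, T, hT, hST.trans (Set.subset_sUnion_of_mem hU)⟩

theorem isOpen_def {U : Set (GuessingSpace f)} :
    IsOpen U ↔ ∀ x ∈ U, ∃ S T, x ∉ T ∧ cell S T x ⊆ U := Iff.rfl

theorem isOpen_cell (S : Finset ι) (T : Finset (GuessingSpace f)) (x : GuessingSpace f) :
    IsOpen (cell S T x) :=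
  isOpen_def.2 fun _ hy => ⟨S, T, hy.1, fun _ hz => ⟨hz.1, fun i hi =>
    (hz.2 i hi).trans (hy.2 i hi)⟩⟩

theorem isClopen_setOf_hits (i : ι) : IsClopen {x : GuessingSpace f | x.Hits i} := by
  refine ⟨isOpen_compl_iff.1 (isOpen_def.2 fun x hx => ?_), isOpen_def.2 fun x hx => ?_⟩
  · exact ⟨{i}, ∅, Finset.notMem_empty x, fun y hy h =>
      hx ((hy.2 i (Finset.mem_singleton_self i)).1 h)⟩
  · exact ⟨{i}, ∅, Finset.notMem_empty x, fun y hy =>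
      (hy.2 i (Finset.mem_singleton_self i)).2 hx⟩

instance : T1Space (GuessingSpace f) where
  t1 x := by
    refine isOpen_compl_iff.1 (isOpen_def.2 fun y hy => ⟨∅, {x}, ?_, fun z hz h => ?_⟩)
    · simpa using hy
    · exact hz.1 (by simpa using h)

instance : Nonempty (GuessingSpace f) := ⟨⟨(0, 0, 0)⟩⟩

instance : Countable (GuessingSpace f) :=
  inferInstanceAs (Countable (ULift.{u} (ℕ × (ℕ →₀ ℕ) × ℕ)))

/-- Finitely many guesses can be right for each of the finitely many functions in `A` and wrong
for those in `B`, provided that the functions in `A` are eventually different from those in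
`B`. -/
theorem exists_guesses (φ : ι → ℕ → ℕ) (A B : Finset ι)
    (h : ∀ a ∈ A, ∀ b ∈ B, ∀ᶠ j in Filter.atTop, φ a j ≠ φ b j) :
    ∃ p : ℕ →₀ ℕ, (∀ a ∈ A, ∃ j, p j = φ a j + 1) ∧ ∀ b ∈ B, ∀ j, p j ≠ φ b j + 1 := by
  classical
  induction A using Finset.induction_on with
  | empty => exact ⟨0, by simp, by simp⟩
  | insert a A _ ih =>
    obtain ⟨p, hpA, hpB⟩ := ih fun a' ha' => h a' (Finset.mem_insert_of_mem ha')
    have h1 : ∀ᶠ j in Filter.atTop, ∀ b ∈ B, φ a j ≠ φ b j :=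
      (Filter.eventually_all_finset B).2 (h a (Finset.mem_insert_self a A))
    have h2 : ∀ᶠ j in Filter.atTop, j ∉ p.support := by
      rw [← Nat.cofinite_eq_atTop]
      exact p.support.eventually_cofinite_notMem
    obtain ⟨j, hj, hjp⟩ := (h1.and h2).exists
    refine ⟨p.update j (φ a j + 1), fun a' ha' => ?_, fun b hb j' => ?_⟩
    · rcases Finset.mem_insert.1 ha' with rfl | ha'
      · exact ⟨j, by simp⟩
      · obtain ⟨j', hj'⟩ := hpA a' ha'
        have hne : j' ≠ j := by
          rintro rfl
          rw [Finsupp.notMem_support_iff.1 hjp] at hj'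
          omega
        exact ⟨j', by simpa [Function.update_of_ne hne] using hj'⟩
    · rcases eq_or_ne j' j with rfl | hne
      · simpa using hj b hb
      · simpa [Function.update_of_ne hne] using hpB b hb j'

/-- Every basic open set meets every column. -/
theorem exists_mem_cell_column
    (hf : ∀ a b, f a ≠ f b → ∀ n, ∀ᶠ j in Filter.atTop, f a n j ≠ f b n j)
    (S : Finset ι) (T : Finset (GuessingSpace f)) (x : GuessingSpace f) (n : ℕ) :
    ∃ y ∈ cell S T x, y.column = n := by
  classical
  obtain ⟨p, hpA, hpB⟩ := exists_guesses (fun i => f i n) (S.filter fun i => x.Hits i)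
    (S.filter fun i => ¬ x.Hits i) (fun a ha b hb => hf a b (by
      intro hab
      have hxa := (Finset.mem_filter.1 ha).2
      rw [Hits, hab] at hxa
      exact (Finset.mem_filter.1 hb).2 hxa) n)
  let y : ℕ → GuessingSpace f := fun k => ⟨(n, p, k)⟩
  have hy : Function.Injective y := fun k l hkl => by
    have := congrArg (fun z : GuessingSpace f => z.down.2.2) hkl
    exact this
  obtain ⟨k, hk⟩ : ∃ k, y k ∉ T := by
    obtain ⟨k, hk⟩ := (T.finite_toSet.preimage hy.injOn).exists_notMem
    exact ⟨k, hk⟩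
  refine ⟨y k, ⟨hk, fun i hi => ?_⟩, rfl⟩
  by_cases hxi : x.Hits i
  · exact iff_of_true (hpA i (Finset.mem_filter.2 ⟨hi, hxi⟩)) hxi
  · exact iff_of_false (fun ⟨j, hj⟩ => hpB i (Finset.mem_filter.2 ⟨hi, hxi⟩) j hj) hxi

theorem isThetaDense_column
    (hf : ∀ a b, f a ≠ f b → ∀ n, ∀ᶠ j in Filter.atTop, f a n j ≠ f b n j) (n : ℕ) :
    IsThetaDense {x : GuessingSpace f | x.column = n} := by
  refine isThetaDense_iff.2 fun U hU ⟨x, hx⟩ => ?_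
  obtain ⟨S, T, -, hST⟩ := hU x hx
  obtain ⟨y, hy, hyn⟩ := exists_mem_cell_column hf S T x n
  exact ⟨y, subset_closure (hST hy), hyn⟩

theorem not_isOpen_singleton
    (hf : ∀ a b, f a ≠ f b → ∀ n, ∀ᶠ j in Filter.atTop, f a n j ≠ f b n j)
    (x : GuessingSpace f) : ¬ IsOpen ({x} : Set (GuessingSpace f)) := by
  intro hU
  obtain ⟨S, T, -, hST⟩ := hU x rfl
  obtain ⟨y, hy, hyn⟩ := exists_mem_cell_column hf S T x (x.column + 1)
  rw [Set.mem_singleton_iff.1 (hST hy)] at hyn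
  omega

theorem thetaPiWeight_le {κ : Cardinal.{u}} (hκ : ℵ₀ ≤ κ) (hι : #ι ≤ κ) :
    thetaPiWeight (GuessingSpace f) ≤ κ := by
  let B : Finset ι × Finset (GuessingSpace f) × GuessingSpace f → Set (GuessingSpace f) :=
    fun q => cell q.1 q.2.1 q.2.2
  have hbase : IsThetaPiBase (B '' {q | q.2.2 ∉ q.2.1}) := by
    refine ⟨?_, fun U hU ⟨x, hx⟩ => ?_⟩
    · rintro _ ⟨q, hq, rfl⟩
      exact ⟨isOpen_cell _ _ _, q.2.2, hq, fun i _ => Iff.rfl⟩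
    · obtain ⟨S, T, hT, hST⟩ := hU x hx
      exact ⟨cell S T x, ⟨(S, T, x), hT, rfl⟩, hST.trans subset_closure⟩
  have hfin : #(Finset ι) ≤ κ := by
    rcases finite_or_infinite ι with hfin | hinf
    · exact (mk_le_aleph0 (α := Finset ι)).trans hκ
    · rwa [mk_finset_of_infinite]
  have hcount : #(Finset (GuessingSpace f) × GuessingSpace f) ≤ κ := mk_le_aleph0.trans hκ
  calc thetaPiWeight (GuessingSpace f) ≤ #(B '' {q | q.2.2 ∉ q.2.1}) :=
        csInf_le' ⟨_, hbase, rfl⟩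
    _ ≤ #(Finset ι × Finset (GuessingSpace f) × GuessingSpace f) :=
        mk_image_le.trans (mk_set_le _)
    _ = #(Finset ι) * #(Finset (GuessingSpace f) × GuessingSpace f) := by
        rw [mk_prod, Cardinal.lift_id, Cardinal.lift_id]
    _ ≤ κ := (mul_le_mul' hfin hcount).trans (mul_eq_self hκ).le

end GuessingSpace

/-- A selector of the columns of a guessing space that meets all clopen sets `{x | x.Hits i}` makes
only finitely many guesses in each column, at most one about each value, and therefore amounts to a
single guessing function. -/
theorem guessesFamilies_of_selectionOne {κ : Cardinal.{u}} (hκ : ℵ₀ ≤ κ)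
    (h : ∀ (X : Type u) [TopologicalSpace X] [T1Space X] [Nonempty X],
      (∀ x : X, ¬ IsOpen ({x} : Set X)) → thetaDensity X = ℵ₀ → thetaPiWeight X ≤ κ →
      SelectionOne (thetaDenseSets X) (thetaDenseSets X)) : GuessesFamilies κ := by
  intro ι hι f
  -- Different functions become eventually different when their initial segments are recorded.
  let F : ι → ℕ → ℕ → ℕ := fun i n j =>
    Encodable.encode ((List.range (Nat.pair n j + 1)).map (f i))
  have hF : ∀ a b, F a ≠ F b → ∀ n, ∀ᶠ j in Filter.atTop, F a n j ≠ F b n j := by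
    intro a b hab n
    have hne : f a ≠ f b := fun heq => hab (by simp only [F, heq])
    obtain ⟨m, hm⟩ := Function.ne_iff.1 hne
    filter_upwards [Filter.eventually_ge_atTop m] with j hj heq
    have hlist := List.map_inj_left.1 (Encodable.encode_injective heq)
    exact hm (hlist m (List.mem_range.2
      (Nat.lt_succ_of_le (hj.trans (Nat.right_le_pair n j)))))
  obtain ⟨b, hb, hdense⟩ := h (GuessingSpace F) (GuessingSpace.not_isOpen_singleton hF)
    (thetaDensity_eq_aleph0 _) (GuessingSpace.thetaPiWeight_le hκ hι)
    (fun n => {x | x.column = n}) (GuessingSpace.isThetaDense_column hF)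
  let g : ℕ → ℕ := fun k =>
    (((Encodable.decode ((b k.unpair.1).guesses k.unpair.2 - 1) : Option (List ℕ)).getD
      []).getLast?).getD 0
  refine ⟨g, fun i => ?_⟩
  have hne : {x : GuessingSpace F | x.Hits i}.Nonempty :=
    ⟨⟨(0, Finsupp.single 0 (F i 0 0 + 1), 0)⟩, 0, Finsupp.single_eq_same⟩
  have hclopen := GuessingSpace.isClopen_setOf_hits (f := F) i
  obtain ⟨x, hx, n, rfl⟩ := isThetaDense_iff.1 hdense _ hclopen.isOpen hne
  rw [hclopen.isClosed.closure_eq] at hx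
  obtain ⟨j, hj⟩ := hx
  rw [show (b n).column = n from hb n] at hj
  refine ⟨Nat.pair n j, ?_⟩
  simp only [g, Nat.unpair_pair, hj, Nat.add_sub_cancel, F, Encodable.encodek, Option.getD_some]
  simp [List.range_succ]

/-! ### The equivalence -/

theorem mainTheorem1 (κ : Cardinal.{u}) (hκ : ℵ₀ ≤ κ) :
    List.TFAE [
      κ < Cardinal.lift.{u} covMeager,
      ∀ (X : Type u) [TopologicalSpace X] [T1Space X] [Nonempty X],
        (∀ x : X, ¬ IsOpen ({x} : Set X)) →
        thetaDensity X = ℵ₀ → thetaPiWeight X ≤ κ →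
        ¬ OneHasWinningStrategy (thetaDenseSets X) (thetaDenseSets X),
      ∀ (X : Type u) [TopologicalSpace X] [T1Space X] [Nonempty X],
        (∀ x : X, ¬ IsOpen ({x} : Set X)) →
        thetaDensity X = ℵ₀ → thetaPiWeight X ≤ κ →
        SelectionOne (thetaDenseSets X) (thetaDenseSets X)] := by
  tfae_have 1 → 2 := fun h X _ _ _ _ hδ hπ => not_oneHasWinningStrategy_of_lt_covMeager h X hδ hπ
  tfae_have 2 → 3 := fun h X _ _ _ hX hδ hπ =>
    selectionOne_of_not_oneHasWinningStrategy (h X hX hδ hπ)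
  tfae_have 3 → 1 := fun h => (guessesFamilies_of_selectionOne hκ h).lt_covMeager hκ
  tfae_finish
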